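/- Let $I$ be a finite index set and let $A=(a_{ij})_{i,j\in I}$ be an E-generalized Cartan matrix: a real matrix with $a_{ii}=2$ for all $i$, with $a_{ij}\le 0$ for $i\ne j$, with $a_{ji}\neq 0$ whenever $a_{ij}\ne 0$, and such that for all $i\neq j$ either $a_{ij}a_{ji}\ge 4$ or $a_{ij}a_{ji}=4\cos^2(\pi/k_{ij})$ for some integer $k_{ij}\ge 2$. For $i \neq j$ put $m_{ij}=k_{ij}$ in the latter case and $m_{ij}=\infty$ in the former. Let $\Gamma$ be the graph with nodes $(\gamma_i)_{i\in I}$ in which $\gamma_i,\gamma_j$ $(i\ne j)$ are joined by an edge if and only if $a_{ij}\neq 0$. Let $W$ be the Coxeter group with generators $(s_i)_{i\in I}$ and relations $s_i^2=1$ and, for $i\ne j$ with $m_{ij}<\infty$, $(s_is_j)^{m_{ij}}=1$; let $\ell$ be its length function. Let $V$ be the real vector space with basis $(\alpha_i)_{i\in I}$, with the (possibly asymmetric) bilinear form $B$ given by $B(\alpha_i,\alpha_j)=\tfrac12 a_{ij}$, and let $W$ act on $V$ by $s_i.v=v-2B(\alpha_i,v)\alpha_i$. Let $\Phi=\{w.\alpha_i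 : w\in W,\ i\in I\}$, let $\Phi^+$ (respectively $\Phi^-$) be the set of those elements of $\Phi$ whose coordinates with respect to $(\alpha_i)$ are all nonnegative (respectively nonpositive), and for $w\in W$ let $$N(w)=\{\alpha\in\Phi^+ : w.\alpha\in\Phi^-\}.$$ Call distinct nodes $\gamma_i,\gamma_j$ odd-neighborly if $m_{ij}$ is finite and odd, and in that case put $K_{ji}=\dfrac{-a_{ji}}{2\cos(\pi/m_{ij})}$; they form an odd asymmetry if moreover $a_{ij}\neq a_{ji}$. An ON-cycle is a sequence $[\gamma_{i_0},\gamma_{i_1},\dots,\gamma_{i_p}]$ $(p\ge 0)$ of nodes with $i_p=i_0$ in which any two consecutive nodes are odd-neighborly. Call $(\Gamma,A)$ unital ON-cyclic if $K_{i_pi_{p-1}}\cdots K_{i_2i_1}K_{i_1i_0}=1$ for every ON-cycle. **Corollary.** The set $N(w)$ is finite for all $w\in W$ if and only if $(\Gamma,A)$ is unital ON-cyclic. Moreover, $|N(w)|=\ell(w)$ for all $w\in W$ if and only if $(\Gamma,A)$ has no odd asymmetries. -/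

import Mathlib

/-- An E-generalized Cartan matrix indexed by `ι`. -/
structure EGCM (ι : Type*) where
  /-- The underlying real matrix. -/
  A : Matrix ι ι ℝ
  diag : ∀ i, A i i = 2
  nonpos : ∀ i j, i ≠ j → A i j ≤ 0
  ne_zero_symm : ∀ i j, A i j ≠ 0 → A j i ≠ 0
  prod_eq : ∀ i j, i ≠ j → 4 ≤ A i j * A j i ∨
    ∃ k : ℕ, 2 ≤ k ∧ A i j * A j i = 4 * Real.cos (Real.pi / k) ^ 2

namespace EGCM

/-! ### The Coxeter group -/

open Classical in
/-- The integer `k ≥ 2` with `x = 4 cos² (π / k)` if there is one (it is then unique),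
and `0` otherwise. As in Mathlib's Coxeter matrices, `0` stands for `∞`. -/
noncomputable def bond (x : ℝ) : ℕ :=
  if h : ∃ k : ℕ, 2 ≤ k ∧ x = 4 * Real.cos (Real.pi / k) ^ 2 then h.choose else 0

theorem bond_ne_one (x : ℝ) : bond x ≠ 1 := by
  unfold bond
  split_ifs with h
  · have := h.choose_spec.1
    omega
  · simp

theorem bond_spec {x : ℝ} (h : bond x ≠ 0) :
    2 ≤ bond x ∧ x = 4 * Real.cos (Real.pi / bond x) ^ 2 := by
  unfold bond at *
  split_ifs at h ⊢ with h'
  · exact h'.choose_spec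
  · simp at h

variable {ι : Type*} [DecidableEq ι] (G : EGCM ι)

/-- The exponents `m i j`, with `0` in the role of `∞`. -/
noncomputable def coxeterMatrix : CoxeterMatrix ι where
  M := Matrix.of fun i j => if i = j then 1 else bond (G.A i j * G.A j i)
  isSymm := by
    ext i j
    simp only [Matrix.transpose_apply, Matrix.of_apply, eq_comm (a := j), mul_comm (G.A j i)]
  diagonal := by simp
  off_diagonal := by
    intro i j h
    simpa [h] using bond_ne_one _

/-- The exponent `m i j` of `s i * s j`, with `0` in the role of `∞`. -/
noncomputable def m (i j : ι) : ℕ := G.coxeterMatrix i j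

/-- The Coxeter group of the matrix: generators `s i`, relations `(s i * s j) ^ m i j = 1`. -/
abbrev W : Type _ := G.coxeterMatrix.Group

/-- The Coxeter group together with its simple generators. -/
noncomputable def cs : CoxeterSystem G.coxeterMatrix G.W := G.coxeterMatrix.toCoxeterSystem

/-- The length function of the Coxeter group with respect to the simple generators. -/
noncomputable def length (w : G.W) : ℕ := G.cs.length w

/-! ### The geometric representation -/

/-- The simple root `α i`, a standard basis vector of `V = ι → ℝ`. -/
def simpleRoot (i : ι) : ι → ℝ := Pi.single i 1

section Representation

variable [Fintype ι]

/-- The (possibly asymmetric) bilinear form with `B (α i) (α j) = (1 / 2) * A i j`. -/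
noncomputable def form : LinearMap.BilinForm ℝ (ι → ℝ) := Matrix.toBilin' ((1 / 2 : ℝ) • G.A)

theorem form_simpleRoot (i j : ι) :
    G.form (simpleRoot i) (simpleRoot j) = 1 / 2 * G.A i j := by
  simp [form, simpleRoot, Matrix.toBilin'_single]

/-- The linear functional `v ↦ 2 B(α i, v)`. -/
noncomputable def coroot (i : ι) : Module.Dual ℝ (ι → ℝ) := (2 : ℝ) • G.form (simpleRoot i)

theorem coroot_simpleRoot (i j : ι) : G.coroot i (simpleRoot j) = G.A i j := by
  simp [coroot, form_simpleRoot]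

theorem coroot_simpleRoot_self (i : ι) : G.coroot i (simpleRoot i) = 2 := by
  rw [coroot_simpleRoot, G.diag]

/-- The reflection `S i : v ↦ v - 2 B(α i, v) α i`. -/
noncomputable def refl (i : ι) : (ι → ℝ) ≃ₗ[ℝ] (ι → ℝ) :=
  Module.reflection (G.coroot_simpleRoot_self i)

theorem refl_apply (i : ι) (v : ι → ℝ) :
    G.refl i v = v - (2 * G.form (simpleRoot i) v) • simpleRoot i := by
  simp [refl, Module.reflection_apply, coroot]

theorem sin_mul_eval_S (θ : ℝ) (k : ℕ) :
    Real.sin θ * (Polynomial.Chebyshev.S ℝ k).eval (2 * Real.cos θ) = Real.sin ((k + 1) * θ) ∧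
    Real.sin θ * (Polynomial.Chebyshev.S ℝ (k - 1)).eval (2 * Real.cos θ)
      = Real.sin (k * θ) := by
  induction k with
  | zero => simp
  | succ k ih =>
    refine ⟨?_, by simpa using ih.1⟩
    push_cast
    rw [Polynomial.Chebyshev.S_add_one]
    simp only [Polynomial.eval_sub, Polynomial.eval_mul, Polynomial.eval_X]
    have e : Real.sin ((k + 1 + 1) * θ) + Real.sin (k * θ)
        = 2 * Real.cos θ * Real.sin ((k + 1) * θ) := by
      have e1 : ((k : ℝ) + 1 + 1) * θ = (k + 1) * θ + θ := by ring
      have e2 : (k : ℝ) * θ = (k + 1) * θ - θ := by ring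
      rw [e1, e2, Real.sin_add, Real.sin_sub]
      ring
    linear_combination 2 * Real.cos θ * ih.1 - ih.2 - e

theorem refl_braid (i j : ι) : (G.refl i * G.refl j) ^ (G.coxeterMatrix i j) = 1 := by
  by_cases hij : i = j
  · subst hij
    rw [G.coxeterMatrix.diagonal, pow_one]
    ext1 v
    simpa [LinearEquiv.mul_apply, refl] using Module.involutive_reflection (G.coroot_simpleRoot_self i) v
  have hM : G.coxeterMatrix i j = bond (G.A i j * G.A j i) := by simp [coxeterMatrix, hij]
  rw [hM]
  by_cases h0 : bond (G.A i j * G.A j i) = 0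
  · rw [h0, pow_zero]
  obtain ⟨hk, hx⟩ := bond_spec h0
  generalize bond (G.A i j * G.A j i) = k at hk hx
  ext1 v
  have key := Module.reflection_mul_reflection_pow_apply (G.coroot_simpleRoot_self i)
    (G.coroot_simpleRoot_self j) k v
  simp only [coroot_simpleRoot] at key
  rw [refl, refl, key]
  obtain rfl | hk3 : k = 2 ∨ 3 ≤ k := by omega
  · have hprod : G.A i j * G.A j i = 0 := by simpa using hx
    have hz : G.A i j = 0 ∧ G.A j i = 0 := by
      by_cases h : G.A i j = 0
      · refine ⟨h, ?_⟩
        by_contra h'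
        exact G.ne_zero_symm _ _ h' h
      · exact absurd hprod (mul_ne_zero h (G.ne_zero_symm _ _ h))
    norm_num [hz.1, hz.2]
    module
  · have hk0 : (0 : ℝ) < k := by positivity
    have hk3' : (3 : ℝ) ≤ k := by exact_mod_cast hk3
    set θ : ℝ := 2 * (Real.pi / k) with hθ
    have ht : G.A i j * G.A j i - 2 = 2 * Real.cos θ := by
      rw [hx, hθ, Real.cos_two_mul]
      ring
    have hkθ : k * θ = 2 * Real.pi := by
      rw [hθ]
      field_simp
    have hθ0 : 0 < θ := by
      have := Real.pi_pos
      positivity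
    have hθπ : θ < Real.pi := by nlinarith [Real.pi_pos]
    have hsin : Real.sin θ ≠ 0 := (Real.sin_pos_of_pos_of_lt_pi hθ0 hθπ).ne'
    rw [ht]
    obtain ⟨n, rfl | rfl⟩ := Nat.even_or_odd' k
    · have e1 : (((2 * n : ℕ) : ℤ) - 2) / 2 = (n : ℤ) - 1 := by omega
      have e2 : (((2 * n : ℕ) : ℤ) - 1) / 2 = (n : ℤ) - 1 := by omega
      have hS : (Polynomial.Chebyshev.S ℝ ((n : ℤ) - 1)).eval (2 * Real.cos θ) = 0 := by
        have h := (sin_mul_eval_S θ n).2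
        have : (n : ℝ) * θ = Real.pi := by
          push_cast at hkθ
          linarith
        rw [this, Real.sin_pi] at h
        exact (mul_eq_zero.mp h).resolve_left hsin
      rw [e1, e2, hS]
      simp
    · have e1 : (((2 * n + 1 : ℕ) : ℤ) - 2) / 2 = (n : ℤ) - 1 := by omega
      have e2 : (((2 * n + 1 : ℕ) : ℤ) - 1) / 2 = (n : ℤ) := by omega
      have e3 : (((2 * n + 1 : ℕ) : ℤ) - 3) / 2 = (n : ℤ) - 1 := by omega
      have e4 : ((2 * n + 1 : ℕ) : ℤ) / 2 = (n : ℤ) := by omega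
      have hS : (Polynomial.Chebyshev.S ℝ (n : ℤ)).eval (2 * Real.cos θ) +
          (Polynomial.Chebyshev.S ℝ ((n : ℤ) - 1)).eval (2 * Real.cos θ) = 0 := by
        obtain ⟨h1, h2⟩ := sin_mul_eval_S θ n
        have : ((n : ℝ) + 1) * θ = 2 * Real.pi - n * θ := by
          push_cast at hkθ
          linarith
        rw [this, Real.sin_two_pi_sub] at h1
        have h : Real.sin θ * ((Polynomial.Chebyshev.S ℝ (n : ℤ)).eval (2 * Real.cos θ) +
          (Polynomial.Chebyshev.S ℝ ((n : ℤ) - 1)).eval (2 * Real.cos θ)) = 0 := by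
          linear_combination h1 + h2
        exact (mul_eq_zero.mp h).resolve_left hsin
      rw [e1, e2, e3, e4, hS]
      simp

/-- The geometric representation `σ`, the homomorphism from the Coxeter group to `GL(V)`
that sends `s i` to `S i`. -/
noncomputable def rep : G.W →* ((ι → ℝ) ≃ₗ[ℝ] (ι → ℝ)) :=
  G.cs.lift ⟨G.refl, G.refl_braid⟩

theorem rep_simple (i : ι) : G.rep (G.cs.simple i) = G.refl i :=
  G.cs.lift_apply_simple G.refl_braid i

/-- The root system `Φ = {w.α i}`. -/
def roots : Set (ι → ℝ) := {v | ∃ (w : G.W) (i : ι), v = G.rep w (simpleRoot i)}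

/-- The positive roots: all coordinates in the basis of simple roots are nonnegative. -/
def posRoots : Set (ι → ℝ) := {v | v ∈ G.roots ∧ ∀ i, 0 ≤ v i}

/-- The negative roots: all coordinates in the basis of simple roots are nonpositive. -/
def negRoots : Set (ι → ℝ) := {v | v ∈ G.roots ∧ ∀ i, v i ≤ 0}

/-- `N(w)`, the set of positive roots sent to negative roots by `w`. -/
def N (w : G.W) : Set (ι → ℝ) := {v | v ∈ G.posRoots ∧ G.rep w v ∈ G.negRoots}

end Representation

/-! ### Odd neighbors -/

/-- Distinct nodes with `m i j` odd (hence finite). -/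
def OddNeighborly (i j : ι) : Prop := i ≠ j ∧ Odd (G.m i j)

/-- Odd-neighborly nodes with `A i j ≠ A j i`. -/
def OddAsymmetry (i j : ι) : Prop := G.OddNeighborly i j ∧ G.A i j ≠ G.A j i

/-- `K j i = - A j i / (2 cos (π / m i j))`, used for odd `m i j`. -/
noncomputable def K (j i : ι) : ℝ := -G.A j i / (2 * Real.cos (Real.pi / G.m i j))

/-- A path of odd neighbors, with nodes `node 0, …, node length`; length zero is allowed. -/
structure ONPath where
  length : ℕ
  node : Fin (length + 1) → ι
  step : ∀ k : Fin length, G.OddNeighborly (node k.castSucc) (node k.succ)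

variable {G} in
/-- The product of the `K (node (k + 1)) (node k)` along the path. -/
noncomputable def ONPath.scalar (P : G.ONPath) : ℝ :=
  ∏ k : Fin P.length, G.K (P.node k.succ) (P.node k.castSucc)

variable {G} in
/-- A cycle of odd neighbors: the start node and the end node agree. -/
def ONPath.IsCycle (P : G.ONPath) : Prop := P.node (Fin.last P.length) = P.node 0

/-- Every cycle of odd neighbors has scalar `1`. -/
def UnitalONCyclic : Prop := ∀ P : G.ONPath, P.IsCycle → P.scalar = 1

end EGCM

/-! Everything reduces to the sets N(s_i). If w s_i is longer than w, then N(w s_i) is the disjoint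
union of N(s_i) and s_i N(w) (`N_mul_simple`), so finiteness and cardinality of all N(w) are decided
by the N(s_i). As s_i changes only coordinate i, N(s_i) consists of the positive multiples of α_i
that are roots (`N_simple`).

Such multiples come from paths of odd neighbors: for c > 0, some w sends α_j to c α_i exactly when a
path from j to i has scalar c (`linked_of_rep_eq`, `exists_rep_eq_scalar_smul`). The hard direction
strips an alternating word in s_j, s_k off the right of w. Its effect on α_j has Chebyshev
coefficients, and these leave a multiple of a single simple root only at length m_jk - 1. The word
then fixes α_j if m_jk is even and sends it to K_kj α_k if m_jk is odd.

A cycle with scalar other than 1 thus yields infinitely many multiples by taking powers, and an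
asymmetric odd bond yields a second multiple. -/

namespace CoxeterSystem

/-! ### Coset decomposition for rank two parabolic subgroups -/

variable {B W : Type*} [Group W] {M : CoxeterMatrix B} (cs : CoxeterSystem M W)

/-- A right descent that has just been removed is no longer a descent, so only the other generator
can come next: the roles of j and k swap at each step. -/
theorem exists_eq_mul_alternatingWord (n : ℕ) : ∀ (w : W) (j k : B), cs.length w = n →
    ¬ cs.IsRightDescent w j → ∃ (u : W) (r : ℕ), w = u * cs.wordProd (alternatingWord j k r) ∧
      cs.length w = cs.length u + r ∧ ¬ cs.IsRightDescent u j ∧ ¬ cs.IsRightDescent u k := by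
  induction n with
  | zero =>
    intro w j k hw _
    obtain rfl := cs.length_eq_zero_iff.1 hw
    exact ⟨1, 0, by simp [alternatingWord], by simp, cs.not_isRightDescent_one j,
      cs.not_isRightDescent_one k⟩
  | succ n ih =>
    intro w j k hw hj
    by_cases hk : cs.IsRightDescent w k
    · obtain ⟨u, r, hu, hl, hk', hj'⟩ := ih (w * cs.simple k) k j
        (by have := cs.isRightDescent_iff.1 hk; omega)
        (cs.isRightDescent_iff_not_isRightDescent_mul.1 hk)
      refine ⟨u, r + 1, ?_, ?_, hj', hk'⟩
      · rw [alternatingWord_succ, wordProd_concat, ← mul_assoc, ← hu,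
          cs.simple_mul_simple_cancel_right]
      · have := cs.isRightDescent_iff.1 hk
        omega
    · exact ⟨w, 0, by simp [alternatingWord], by simp, hj, hk⟩

/-- If `w` has the right descent `k` but not `j`, then `w` is the product of an element without
either descent and a nontrivial alternating word that is shorter than the braid word. -/
theorem exists_eq_mul_alternatingWord_of_isRightDescent {w : W} {j k : B}
    (hj : ¬ cs.IsRightDescent w j) (hk : cs.IsRightDescent w k) :
    ∃ (u : W) (r : ℕ), w = u * cs.wordProd (alternatingWord j k r) ∧
      cs.length u < cs.length w ∧ ¬ cs.IsRightDescent u j ∧ ¬ cs.IsRightDescent u k ∧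
      1 ≤ r ∧ (M j k ≠ 0 → r < M j k) := by
  obtain ⟨u, r, hu, hl, huj, huk⟩ := cs.exists_eq_mul_alternatingWord _ w j k rfl hj
  have hr : 1 ≤ r := by
    rcases Nat.eq_zero_or_pos r with rfl | h
    · rw [show w = u by simpa [alternatingWord] using hu] at hk
      exact absurd hk huk
    · exact h
  refine ⟨u, r, hu, by omega, huj, huk, hr, fun h0 => ?_⟩
  by_contra hlt
  -- If r were at least M j k, appending j would give a nonreduced word, so w s_j could not be
  -- longer than w, although j is not a descent.
  have hnr : ¬ cs.IsReduced (alternatingWord k j (r + 1)) :=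
    cs.not_isReduced_alternatingWord k j (by rwa [M.symmetric]) (by rw [M.symmetric]; omega)
  have hle := cs.length_wordProd_le (alternatingWord k j (r + 1))
  rw [IsReduced] at hnr
  rw [length_alternatingWord] at hle hnr
  have hw : w * cs.simple j = u * cs.wordProd (alternatingWord k j (r + 1)) := by
    rw [alternatingWord_succ, wordProd_concat, ← mul_assoc, ← hu]
  have h1 := cs.not_isRightDescent_iff.1 hj
  have h2 := cs.length_mul_le u (cs.wordProd (alternatingWord k j (r + 1)))
  rw [← hw] at h2
  omega

end CoxeterSystem

namespace EGCM

/-! ### Signs of Chebyshev values -/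

theorem eval_S_two_mul_cos_pi_div {m : ℕ} (hm : 2 ≤ m) (n : ℕ) :
    (Polynomial.Chebyshev.S ℝ n).eval (2 * Real.cos (Real.pi / m)) =
      Real.sin ((n + 1) * (Real.pi / m)) / Real.sin (Real.pi / m) := by
  have h2 : (2 : ℝ) ≤ m := by exact_mod_cast hm
  have hs : 0 < Real.sin (Real.pi / m) := by
    apply Real.sin_pos_of_pos_of_lt_pi (by positivity)
    rw [div_lt_iff₀ (by positivity)]
    nlinarith [Real.pi_pos]
  rw [eq_div_iff hs.ne', mul_comm]
  exact (sin_mul_eval_S _ n).1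

theorem eval_S_pos_of_lt {m n : ℕ} (hm : 2 ≤ m) (hn : n + 1 < m) :
    0 < (Polynomial.Chebyshev.S ℝ n).eval (2 * Real.cos (Real.pi / m)) := by
  have h2 : (2 : ℝ) ≤ m := by exact_mod_cast hm
  have hn' : (n : ℝ) + 1 < m := by exact_mod_cast hn
  have key : ∀ x : ℝ, 0 < x → x < m → 0 < Real.sin (x * (Real.pi / m)) := by
    intro x hx hxm
    apply Real.sin_pos_of_pos_of_lt_pi (by positivity)
    rw [← mul_div_assoc, div_lt_iff₀ (by positivity)]
    nlinarith [Real.pi_pos]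
  rw [eval_S_two_mul_cos_pi_div hm]
  have := key 1 one_pos (by linarith)
  rw [one_mul] at this
  exact div_pos (key _ (by positivity) hn') this

theorem eval_S_pred_eq_zero {m : ℕ} (hm : 2 ≤ m) :
    (Polynomial.Chebyshev.S ℝ ((m - 1 : ℕ) : ℤ)).eval (2 * Real.cos (Real.pi / m)) = 0 := by
  rw [eval_S_two_mul_cos_pi_div hm, Nat.cast_sub (by omega)]
  have : (m : ℝ) ≠ 0 := by positivity
  have e : ((m : ℝ) - (1 : ℕ) + 1) * (Real.pi / m) = Real.pi := by
    push_cast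
    field_simp
    ring
  rw [e, Real.sin_pi, zero_div]

theorem eval_S_pred_pred_eq_one {m : ℕ} (hm : 2 ≤ m) :
    (Polynomial.Chebyshev.S ℝ (((m - 1 : ℕ) : ℤ) - 1)).eval (2 * Real.cos (Real.pi / m)) = 1 := by
  have h := eval_S_two_mul_cos_pi_div hm (m - 2)
  have h2 : (2 : ℝ) ≤ m := by exact_mod_cast hm
  have hs : 0 < Real.sin (Real.pi / m) := by
    apply Real.sin_pos_of_pos_of_lt_pi (by positivity)
    rw [div_lt_iff₀ (by positivity)]
    nlinarith [Real.pi_pos]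
  have : (m : ℝ) ≠ 0 := by positivity
  have e : (((m - 2 : ℕ) : ℝ) + 1) * (Real.pi / m) = Real.pi - Real.pi / m := by
    rw [Nat.cast_sub hm]
    push_cast
    field_simp
    ring
  rw [e, Real.sin_pi_sub, div_self hs.ne'] at h
  have e' : (((m - 1 : ℕ) : ℤ) - 1) = ((m - 2 : ℕ) : ℤ) := by omega
  rw [e', h]

/-- Monotonicity is carried along to make the induction work: t S_n - S_(n-1) ≥ 2 S_n - S_n = S_n.
-/
theorem eval_S_pos_of_two_le {t : ℝ} (ht : 2 ≤ t) (n : ℕ) :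
    0 < (Polynomial.Chebyshev.S ℝ n).eval t ∧
      (Polynomial.Chebyshev.S ℝ ((n : ℤ) - 1)).eval t ≤ (Polynomial.Chebyshev.S ℝ n).eval t := by
  induction n with
  | zero => simp
  | succ n ih =>
    push_cast
    rw [add_sub_cancel_right, Polynomial.Chebyshev.S_add_one]
    simp only [Polynomial.eval_sub, Polynomial.eval_mul, Polynomial.eval_X]
    constructor <;> nlinarith

/-! ### Symmetrizing a pair of simple roots -/

variable {ι : Type*} [DecidableEq ι] (G : EGCM ι)

theorem simpleRoot_nonneg (i : ι) : 0 ≤ (simpleRoot i : ι → ℝ) := by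
  intro x
  by_cases h : x = i <;> simp [simpleRoot, h]

/-- The data that make the simple roots `j` and `k` symmetric: after scaling the root `k` by `d`,
both off-diagonal entries become `-t`. -/
structure RankTwo (j k : ι) (d t : ℝ) : Prop where
  pos : 0 < d
  left : G.A k j = -(t * d)
  right : d * G.A j k = -t
  value : (G.m j k = 0 ∧ 2 ≤ t) ∨ (2 ≤ G.m j k ∧ t = 2 * Real.cos (Real.pi / G.m j k))

theorem exists_rankTwo {j k : ι} (h : j ≠ k) : ∃ d t, G.RankTwo j k d t := by
  have hm : G.m j k = bond (G.A j k * G.A k j) := by simp [m, coxeterMatrix, h]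
  have hval : (G.m j k = 0 ∧ 4 ≤ G.A j k * G.A k j) ∨
      (2 ≤ G.m j k ∧ G.A j k * G.A k j = 4 * Real.cos (Real.pi / G.m j k) ^ 2) := by
    by_cases h0 : G.m j k = 0
    · refine .inl ⟨h0, (G.prod_eq j k h).resolve_right fun hex => ?_⟩
      have : bond (G.A j k * G.A k j) ≠ 0 := by
        rw [bond, dif_pos hex]
        have := hex.choose_spec.1
        omega
      exact this (hm ▸ h0)
    · rw [hm] at h0 ⊢
      exact .inr (bond_spec h0)
  have ha := G.nonpos j k h
  have hb := G.nonpos k j h.symm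
  have ht : (G.m j k = 0 ∧ 2 ≤ √(G.A j k * G.A k j)) ∨
      (2 ≤ G.m j k ∧ √(G.A j k * G.A k j) = 2 * Real.cos (Real.pi / G.m j k)) := by
    rcases hval with ⟨h0, h4⟩ | ⟨h2, h4⟩
    · exact .inl ⟨h0, Real.le_sqrt_of_sq_le (by linarith)⟩
    · refine .inr ⟨h2, ?_⟩
      have h2' : (2 : ℝ) ≤ G.m j k := by exact_mod_cast h2
      have hc : 0 ≤ Real.cos (Real.pi / G.m j k) := by
        apply Real.cos_nonneg_of_neg_pi_div_two_le_of_le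
        · have : 0 ≤ Real.pi / G.m j k := by positivity
          linarith [Real.pi_pos]
        · exact div_le_div_of_nonneg_left Real.pi_pos.le two_pos h2'
      rw [h4, show 4 * Real.cos (Real.pi / G.m j k) ^ 2 = (2 * Real.cos (Real.pi / G.m j k)) ^ 2
        by ring, Real.sqrt_sq (by linarith)]
  by_cases hz : G.A j k = 0
  · have hz' : G.A k j = 0 := by
      by_contra h'
      exact G.ne_zero_symm _ _ h' hz
    -- For an orthogonal pair t = 0, so any positive scale would do.
    exact ⟨1, _, one_pos, by simp [hz'], by simp [hz], ht⟩
  · have ha' : 0 < -G.A j k := by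
      rcases ha.lt_or_eq with h | h
      · linarith
      · exact absurd h hz
    have hb' : 0 < -G.A k j := by
      rcases hb.lt_or_eq with h | h
      · linarith
      · exact absurd h (G.ne_zero_symm _ _ hz)
    have hsq : √(G.A j k * G.A k j) ^ 2 = G.A j k * G.A k j := Real.sq_sqrt (by nlinarith)
    have hpos : 0 < √(G.A j k * G.A k j) := Real.sqrt_pos.2 (by nlinarith)
    refine ⟨√(G.A j k * G.A k j) / -G.A j k, _, by positivity, ?_, ?_, ht⟩
    · rw [mul_div_assoc', eq_comm, neg_eq_iff_eq_neg, div_eq_iff ha'.ne', ← sq, hsq]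
      ring
    · field_simp

variable {G}

/-- An odd exponent is at least 3, so t = 2 cos(π/m) is nonzero and cancels from t d / t. -/
theorem RankTwo.K_eq {j k : ι} {d t : ℝ} (h : G.RankTwo j k d t) (ho : Odd (G.m j k)) :
    G.K k j = d := by
  rcases h.value with ⟨h0, _⟩ | ⟨h2, ht⟩
  · simp [h0] at ho
  have h3 : (3 : ℝ) ≤ G.m j k := by
    obtain ⟨r, hr⟩ := ho
    exact_mod_cast (by omega : 3 ≤ G.m j k)
  have hc : 0 < Real.cos (Real.pi / G.m j k) := by
    apply Real.cos_pos_of_mem_Ioo ⟨?_, ?_⟩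
    · have : 0 ≤ Real.pi / G.m j k := by positivity
      linarith [Real.pi_pos]
    · exact div_lt_div_of_pos_left Real.pi_pos two_pos (by linarith)
  rw [K, h.left, ht]
  field_simp

theorem RankTwo.eval_pos {j k : ι} {d t : ℝ} (h : G.RankTwo j k d t) {r : ℕ}
    (hr : G.m j k ≠ 0 → r + 1 < G.m j k) : 0 < (Polynomial.Chebyshev.S ℝ r).eval t := by
  rcases h.value with ⟨_, ht⟩ | ⟨h2, rfl⟩
  · exact (eval_S_pos_of_two_le ht r).1
  · exact eval_S_pos_of_lt h2 (hr (by omega))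

theorem simpleRoot_ne_zero (i : ι) : (simpleRoot i : ι → ℝ) ≠ 0 := by
  simp [simpleRoot]

/-- A sum of two nonnegative vectors that is a multiple of a simple root splits into multiples of
that root. -/
theorem eq_smul_simpleRoot_of_add_eq {u v : ι → ℝ} {i : ι} {c : ℝ} (hu : 0 ≤ u) (hv : 0 ≤ v)
    (h : u + v = c • simpleRoot i) : u = u i • simpleRoot i := by
  ext x
  by_cases hx : x = i
  · subst hx
    simp [simpleRoot]
  · have h1 := congrFun h x
    have h2 := hu x
    have h3 := hv x
    simp [simpleRoot, hx] at h1 h2 h3 ⊢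
    linarith

/-! ### Paths of odd neighbors -/

variable (G) in
/-- `G.Linked j i c`: there is a path of odd neighbors from `j` to `i` with scalar `c`. -/
def Linked (j i : ι) (c : ℝ) : Prop :=
  ∃ P : G.ONPath, P.node 0 = j ∧ P.node (Fin.last P.length) = i ∧ P.scalar = c

theorem Linked.refl (i : ι) : G.Linked i i 1 :=
  ⟨⟨0, fun _ => i, fun k => k.elim0⟩, rfl, rfl, by simp [ONPath.scalar]⟩

theorem Linked.cons {j k i : ι} {c : ℝ} (h : G.OddNeighborly j k) (hl : G.Linked k i c) :
    G.Linked j i (c * G.K k j) := by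
  obtain ⟨P, h0, h1, rfl⟩ := hl
  refine ⟨⟨P.length + 1, Fin.cons (α := fun _ => ι) j P.node, fun r => ?_⟩, ?_, ?_, ?_⟩
  · refine Fin.cases ?_ (fun r => ?_) r
    · simpa [h0] using h
    · simpa [← Fin.succ_castSucc] using P.step r
  · exact Fin.cons_zero (α := fun _ => ι) j P.node
  · rw [← Fin.succ_last]
    simpa using h1
  · rw [ONPath.scalar, Fin.prod_univ_succ, mul_comm]
    simp [ONPath.scalar, h0]

theorem induction_on_length {p : G.W → Prop} (one : p 1)
    (step : ∀ w i, ¬ G.cs.IsRightDescent w i → p w → p (w * G.cs.simple i)) (n : ℕ) :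
    ∀ w, G.cs.length w = n → p w := by
  induction n with
  | zero =>
    intro w hw
    obtain rfl := G.cs.length_eq_zero_iff.1 hw
    exact one
  | succ n ih =>
    intro w hw
    have h1 : w ≠ 1 := by
      rintro rfl
      simp at hw
    obtain ⟨k, hk⟩ := G.cs.exists_rightDescent_of_ne_one h1
    have h2 := step (w * G.cs.simple k) k (G.cs.isRightDescent_iff_not_isRightDescent_mul.1 hk)
      (ih _ (by have := G.cs.isRightDescent_iff.1 hk; omega))
    rwa [G.cs.simple_mul_simple_cancel_right] at h2

theorem smul_simpleRoot_injective (i : ι) :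
    Function.Injective fun c : ℝ => c • (simpleRoot i : ι → ℝ) := by
  intro a b h
  have := congrFun h i
  simpa [simpleRoot] using this

/-- Here K is the scale d, and symmetry of the entries reads t (d² - 1) = 0 with t ≠ 0 and d > 0. -/
theorem K_eq_one_iff {j k : ι} (h : G.OddNeighborly j k) : G.K k j = 1 ↔ G.A j k = G.A k j := by
  obtain ⟨d, t, hR⟩ := G.exists_rankTwo h.1
  rw [hR.K_eq h.2]
  have h1 := hR.left
  have h2 := hR.right
  constructor
  · rintro rfl
    linarith
  · intro he
    have ht : t ≠ 0 := by
      rintro rfl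
      rcases hR.value with ⟨h0, h2'⟩ | ⟨h2', ht⟩
      · linarith
      · have hz : Real.cos (Real.pi / G.m j k) = 0 := by linarith
        have h3 : (3 : ℝ) ≤ G.m j k := by
          obtain ⟨r, hr⟩ := h.2
          exact_mod_cast (by omega : 3 ≤ G.m j k)
        refine absurd hz (Real.cos_pos_of_mem_Ioo ⟨?_, ?_⟩).ne'
        · have : 0 ≤ Real.pi / G.m j k := by positivity
          linarith [Real.pi_pos]
        · exact div_lt_div_of_pos_left Real.pi_pos two_pos (by linarith)
    rw [he, h1] at h2
    have h3 : t * ((d - 1) * (d + 1)) = 0 := by linear_combination -h2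
    have h4 := (mul_eq_zero.1 h3).resolve_left ht
    have h5 := (mul_eq_zero.1 h4).resolve_right (by linarith [hR.pos])
    linarith

/-! ### Roots are positive or negative -/

section Representation

variable [Fintype ι]

theorem refl_simpleRoot (i j : ι) :
    G.refl i (simpleRoot j) = simpleRoot j - G.A i j • simpleRoot i := by
  rw [refl_apply, form_simpleRoot]
  congr 2
  ring

theorem refl_simpleRoot_self (i : ι) : G.refl i (simpleRoot i) = -simpleRoot i := by
  rw [refl_simpleRoot, G.diag]
  module

theorem refl_apply_of_ne (i : ι) (v : ι → ℝ) {x : ι} (h : x ≠ i) : G.refl i v x = v x := by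
  rw [refl_apply]
  simp [simpleRoot, h]

theorem rep_mul_apply (u v : G.W) (x : ι → ℝ) : G.rep (u * v) x = G.rep u (G.rep v x) := by
  rw [map_mul]
  rfl

theorem rep_inv_apply_rep_apply (u : G.W) (x : ι → ℝ) : G.rep u⁻¹ (G.rep u x) = x := by
  rw [← rep_mul_apply]
  simp

/-- The action of an alternating word on a simple root, through Chebyshev polynomials. -/
theorem RankTwo.rep_alternatingWord {j k : ι} {d t : ℝ} (h : G.RankTwo j k d t) (r : ℕ) :
    G.rep (G.cs.wordProd (CoxeterSystem.alternatingWord j k r)) (simpleRoot j) =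
      if Even r then
        (Polynomial.Chebyshev.S ℝ r).eval t • simpleRoot j +
          (Polynomial.Chebyshev.S ℝ ((r : ℤ) - 1)).eval t • d • simpleRoot k
      else
        (Polynomial.Chebyshev.S ℝ ((r : ℤ) - 1)).eval t • simpleRoot j +
          (Polynomial.Chebyshev.S ℝ r).eval t • d • simpleRoot k := by
  induction r with
  | zero => simp [CoxeterSystem.alternatingWord]
  | succ r ih =>
    rw [CoxeterSystem.alternatingWord_succ', CoxeterSystem.wordProd_cons, rep_mul_apply, ih,
      rep_simple]
    push_cast
    rw [add_sub_cancel_right, Polynomial.Chebyshev.S_add_one]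
    simp only [Polynomial.eval_sub, Polynomial.eval_mul, Polynomial.eval_X, Nat.even_add_one]
    have hr := h.right
    by_cases he : Even r
    · simp only [he, if_true, not_true, if_false, map_add, map_smul, refl_simpleRoot_self,
        refl_simpleRoot k j, h.left]
      module
    · simp only [he, if_true, not_false_iff, if_false, map_add, map_smul, refl_simpleRoot_self,
        refl_simpleRoot j k]
      rw [smul_sub d, smul_smul d, h.right]
      module

/-- With w = u times an alternating word, w α_j is a nonnegative combination of u α_j and u α_k, and
induction applies to the shorter u. -/
theorem rep_simpleRoot_nonneg (n : ℕ) : ∀ (w : G.W) (j : ι), G.cs.length w = n →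
    ¬ G.cs.IsRightDescent w j → 0 ≤ G.rep w (simpleRoot j) := by
  induction n using Nat.strong_induction_on with
  | _ n ih =>
    intro w j hw hj
    by_cases h1 : w = 1
    · subst h1
      simpa using simpleRoot_nonneg j
    obtain ⟨k, hk⟩ := G.cs.exists_rightDescent_of_ne_one h1
    have hjk : j ≠ k := by
      rintro rfl
      exact hj hk
    obtain ⟨u, r, hu, hlt, huj, huk, hr, hrm⟩ :=
      G.cs.exists_eq_mul_alternatingWord_of_isRightDescent hj hk
    obtain ⟨d, t, h⟩ := G.exists_rankTwo hjk
    have hj0 := ih _ (hw ▸ hlt) u j rfl huj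
    have hk0 := ih _ (hw ▸ hlt) u k rfl huk
    have hS' : 0 < (Polynomial.Chebyshev.S ℝ ((r : ℤ) - 1)).eval t := by
      have e : (r : ℤ) - 1 = ((r - 1 : ℕ) : ℤ) := by omega
      rw [e]
      exact h.eval_pos fun h0 => by have := hrm h0; change r < G.m j k at this; omega
    have hS : 0 ≤ (Polynomial.Chebyshev.S ℝ r).eval t := by
      -- At r = m - 1 the coefficient vanishes; for smaller r it is positive.
      by_cases hlast : G.m j k ≠ 0 ∧ r + 1 = G.m j k
      · rcases h.value with ⟨h0, _⟩ | ⟨h2, rfl⟩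
        · exact absurd h0 hlast.1
        · rw [show r = G.m j k - 1 by omega, eval_S_pred_eq_zero h2]
      · exact (h.eval_pos fun h0 => by
          have := hrm h0
          change r < G.m j k at this
          omega).le
    have hd := h.pos
    rw [hu, rep_mul_apply, h.rep_alternatingWord]
    split_ifs <;>
    · simp only [map_add, map_smul]
      positivity

theorem rep_simpleRoot_nonneg_of_not_isRightDescent {w : G.W} {j : ι}
    (hj : ¬ G.cs.IsRightDescent w j) : 0 ≤ G.rep w (simpleRoot j) :=
  rep_simpleRoot_nonneg _ w j rfl hj

theorem rep_simpleRoot_nonpos_of_isRightDescent {w : G.W} {j : ι}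
    (hj : G.cs.IsRightDescent w j) : G.rep w (simpleRoot j) ≤ 0 := by
  have h := rep_simpleRoot_nonneg_of_not_isRightDescent
    (G.cs.isRightDescent_iff_not_isRightDescent_mul.1 hj)
  rw [rep_mul_apply, rep_simple, refl_simpleRoot_self, map_neg] at h
  exact neg_nonneg.1 h

theorem ne_zero_of_mem_roots {v : ι → ℝ} (h : v ∈ G.roots) : v ≠ 0 := by
  obtain ⟨w, i, rfl⟩ := h
  simpa using simpleRoot_ne_zero i

theorem nonneg_or_nonpos_of_mem_roots {v : ι → ℝ} (h : v ∈ G.roots) : 0 ≤ v ∨ v ≤ 0 := by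
  obtain ⟨w, i, rfl⟩ := h
  by_cases hd : G.cs.IsRightDescent w i
  · exact .inr (rep_simpleRoot_nonpos_of_isRightDescent hd)
  · exact .inl (rep_simpleRoot_nonneg_of_not_isRightDescent hd)

theorem rep_mem_roots {v : ι → ℝ} (w : G.W) (h : v ∈ G.roots) : G.rep w v ∈ G.roots := by
  obtain ⟨u, i, rfl⟩ := h
  exact ⟨w * u, i, (rep_mul_apply _ _ _).symm⟩

theorem simpleRoot_mem_roots (i : ι) : (simpleRoot i : ι → ℝ) ∈ G.roots := ⟨1, i, by simp⟩

/-! ### Multiples of simple roots among the roots -/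

/-- Both summands would lie on the line of α_i, whereas u is injective and keeps α_j and α_k
independent. -/
theorem not_smul_add_smul_eq {u : G.W} {i j k : ι} (hjk : j ≠ k) {c p q : ℝ}
    (hj : 0 ≤ G.rep u (simpleRoot j)) (hk : 0 ≤ G.rep u (simpleRoot k)) (hp : 0 < p) (hq : 0 < q) :
    p • G.rep u (simpleRoot j) + q • G.rep u (simpleRoot k) ≠ c • simpleRoot i := by
  intro h
  have h1 := eq_smul_simpleRoot_of_add_eq (by positivity) (by positivity) h
  rw [add_comm] at h
  have h2 := eq_smul_simpleRoot_of_add_eq (by positivity) (by positivity) h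
  set x := (p • G.rep u (simpleRoot j)) i
  set y := (q • G.rep u (simpleRoot k)) i
  have h3 : G.rep u ((y * p) • simpleRoot j - (x * q) • simpleRoot k) = 0 := by
    rw [map_sub, map_smul, map_smul, mul_smul, mul_smul, h1, h2]
    module
  have h4 := (LinearEquiv.map_eq_zero_iff _).1 h3
  have h5 := congrFun h4 j
  have h6 : y = 0 := by simpa [simpleRoot, hjk, hp.ne'] using h5
  rw [h6, zero_smul] at h2
  simp [hq.ne', simpleRoot_ne_zero] at h2

theorem linked_of_rep_eq (n : ℕ) : ∀ (w : G.W) (j i : ι) (c : ℝ), G.cs.length w = n → 0 < c →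
    G.rep w (simpleRoot j) = c • simpleRoot i → G.Linked j i c := by
  induction n using Nat.strong_induction_on with
  | _ n ih =>
    intro w j i c hw hc heq
    by_cases h1 : w = 1
    · subst h1
      have hi := congrFun heq i
      have hj := congrFun heq j
      have hji : j = i := by
        by_contra hne
        simp [simpleRoot, hne] at hj
      subst hji
      have : c = 1 := by simpa [simpleRoot] using hi.symm
      rw [this]
      exact Linked.refl j
    obtain ⟨k, hk⟩ := G.cs.exists_rightDescent_of_ne_one h1
    have hj : ¬ G.cs.IsRightDescent w j := by
      intro hj
      have := rep_simpleRoot_nonpos_of_isRightDescent hj i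
      rw [heq] at this
      simp [simpleRoot] at this
      linarith
    have hjk : j ≠ k := by
      rintro rfl
      exact hj hk
    obtain ⟨u, r, hu, hlt, huj, huk, hr, hrm⟩ :=
      G.cs.exists_eq_mul_alternatingWord_of_isRightDescent hj hk
    obtain ⟨d, t, h⟩ := G.exists_rankTwo hjk
    have hd := h.pos
    have hj0 := rep_simpleRoot_nonneg_of_not_isRightDescent huj
    have hk0 := rep_simpleRoot_nonneg_of_not_isRightDescent huk
    have hS' : 0 < (Polynomial.Chebyshev.S ℝ ((r : ℤ) - 1)).eval t := by
      have e : (r : ℤ) - 1 = ((r - 1 : ℕ) : ℤ) := by omega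
      rw [e]
      exact h.eval_pos fun h0 => by have := hrm h0; change r < G.m j k at this; omega
    rw [hu, rep_mul_apply, h.rep_alternatingWord] at heq
    by_cases hlast : G.m j k ≠ 0 ∧ r + 1 = G.m j k
    · rcases h.value with ⟨h0, _⟩ | ⟨h2, ht⟩
      · exact absurd h0 hlast.1
      have e : r = G.m j k - 1 := by omega
      have hz : (Polynomial.Chebyshev.S ℝ r).eval t = 0 := by rw [e, ht, eval_S_pred_eq_zero h2]
      have hone : (Polynomial.Chebyshev.S ℝ ((r : ℤ) - 1)).eval t = 1 := by
        rw [e, ht, eval_S_pred_pred_eq_one h2]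
      rw [hz, hone] at heq
      -- As r = m - 1, even r means odd m: the word moves α_j to d α_k, and the path gains its first
      -- edge. For even m it fixes α_j, and u alone does the rest.
      split_ifs at heq with he
      · have ho : Odd (G.m j k) := by
          rw [← hlast.2]
          exact he.add_one
        simp only [zero_smul, zero_add, one_smul, map_smul] at heq
        have heq' : G.rep u (simpleRoot k) = (c / d) • simpleRoot i := by
          rw [div_eq_inv_mul, mul_smul, ← heq, smul_smul, inv_mul_cancel₀ hd.ne', one_smul]
        have hl := (ih _ (hw ▸ hlt) u k i (c / d) rfl (by positivity) heq').cons ⟨hjk, ho⟩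
        rwa [h.K_eq ho, div_mul_cancel₀ _ hd.ne'] at hl
      · simp only [zero_smul, add_zero, one_smul] at heq
        exact ih _ (hw ▸ hlt) u j i c rfl hc heq
    · have hS : 0 < (Polynomial.Chebyshev.S ℝ r).eval t :=
        h.eval_pos fun h0 => by
          have := hrm h0
          change r < G.m j k at this
          omega
      split_ifs at heq <;>
      · rw [map_add, map_smul, map_smul, map_smul, smul_smul _ d] at heq
        exact absurd heq (not_smul_add_smul_eq hjk hj0 hk0 (by positivity) (by positivity))

/-- An odd bond moves one simple root to a multiple of the other. -/
theorem exists_rep_eq_K_smul {j k : ι} (h : G.OddNeighborly j k) :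
    0 < G.K k j ∧ ∃ w : G.W, G.rep w (simpleRoot j) = G.K k j • simpleRoot k := by
  obtain ⟨d, t, hR⟩ := G.exists_rankTwo h.1
  rw [hR.K_eq h.2]
  refine ⟨hR.pos, G.cs.wordProd (CoxeterSystem.alternatingWord j k (G.m j k - 1)), ?_⟩
  rcases hR.value with ⟨h0, _⟩ | ⟨h2, ht⟩
  · have := h.2
    simp [h0] at this
  have he : Even (G.m j k - 1) := by
    obtain ⟨r, hr⟩ := h.2
    exact ⟨r, by omega⟩
  rw [hR.rep_alternatingWord, if_pos he, ht, eval_S_pred_eq_zero h2, eval_S_pred_pred_eq_one h2]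
  module

theorem exists_rep_eq_scalar_smul (n : ℕ) : ∀ P : G.ONPath, P.length = n →
    0 < P.scalar ∧ ∃ w : G.W, G.rep w (simpleRoot (P.node 0)) =
      P.scalar • simpleRoot (P.node (Fin.last P.length)) := by
  induction n with
  | zero =>
    rintro ⟨l, node, step⟩ (rfl : l = 0)
    exact ⟨by simp [ONPath.scalar], 1, by simp [ONPath.scalar]⟩
  | succ n ih =>
    rintro ⟨l, node, step⟩ (rfl : l = n + 1)
    obtain ⟨hpos, w, hw⟩ := ih ⟨n, fun r => node r.succ, fun r => step r.succ⟩ rfl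
    obtain ⟨hK, v, hv⟩ := exists_rep_eq_K_smul (step 0)
    have hs : ONPath.scalar ⟨n + 1, node, step⟩ =
        G.K (node 1) (node 0) * ONPath.scalar (G := G)
          ⟨n, fun r => node r.succ, fun r => step r.succ⟩ := by
      simp [ONPath.scalar, Fin.prod_univ_succ]
    rw [hs]
    refine ⟨mul_pos hK hpos, w * v, ?_⟩
    rw [rep_mul_apply]
    change G.rep v (simpleRoot (node 0)) = G.K (node 1) (node 0) • simpleRoot (node 1) at hv
    change G.rep w (simpleRoot (node 1)) = _ at hw
    rw [hv, map_smul, hw, smul_smul]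
    rfl

/-! ### Inversion sets -/

theorem N_simple (i : ι) :
    G.N (G.cs.simple i) = {v | v ∈ G.roots ∧ ∃ c : ℝ, 0 < c ∧ v = c • simpleRoot i} := by
  ext v
  constructor
  · rintro ⟨⟨hv, hpos⟩, -, hneg⟩
    have hz : ∀ x, x ≠ i → v x = 0 := by
      intro x hx
      have h1 := hneg x
      rw [rep_simple, refl_apply_of_ne _ _ hx] at h1
      exact le_antisymm h1 (hpos x)
    have he : v = v i • simpleRoot i := by
      ext x
      by_cases hx : x = i
      · subst hx
        simp [simpleRoot]
      · simp [simpleRoot, hx, hz]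
    refine ⟨hv, v i, lt_of_le_of_ne (hpos i) fun h0 => ne_zero_of_mem_roots hv ?_, he⟩
    rw [he, ← h0, zero_smul]
  · rintro ⟨hv, c, hc, rfl⟩
    have h0 : 0 ≤ c • (simpleRoot i : ι → ℝ) := smul_nonneg hc.le (simpleRoot_nonneg i)
    refine ⟨⟨hv, h0⟩, rep_mem_roots _ hv, ?_⟩
    rw [map_smul, rep_simple, refl_simpleRoot_self, smul_neg]
    exact neg_nonpos.2 h0

theorem refl_nonneg_of_not_mem {v : ι → ℝ} (i : ι) (hv : v ∈ G.posRoots)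
    (h : v ∉ G.N (G.cs.simple i)) : 0 ≤ G.rep (G.cs.simple i) v := by
  have hr := rep_mem_roots (G.cs.simple i) hv.1
  refine (nonneg_or_nonpos_of_mem_roots hr).resolve_right fun hn => h ⟨hv, hr, hn⟩

theorem rep_simple_rep_simple (i : ι) (v : ι → ℝ) :
    G.rep (G.cs.simple i) (G.rep (G.cs.simple i) v) = v := by
  rw [← rep_mul_apply]
  simp

/-- Outside N(s_i), the reflection s_i keeps positive roots positive; on N(s_i), w preserves
positivity because w α_i ≥ 0. -/
theorem N_mul_simple {w : G.W} {i : ι} (h : ¬ G.cs.IsRightDescent w i) :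
    G.N (w * G.cs.simple i) = G.N (G.cs.simple i) ∪ G.rep (G.cs.simple i) '' G.N w ∧
      Disjoint (G.N (G.cs.simple i)) (G.rep (G.cs.simple i) '' G.N w) := by
  have hw := rep_simpleRoot_nonneg_of_not_isRightDescent h
  have hnot : ∀ v ∈ G.N w, v ∉ G.N (G.cs.simple i) := by
    rintro v hv hv'
    rw [N_simple] at hv'
    obtain ⟨hr, c, hc, rfl⟩ := hv'
    have h1 : 0 ≤ G.rep w (c • simpleRoot i) := by
      rw [map_smul]
      exact smul_nonneg hc.le hw
    exact ne_zero_of_mem_roots (rep_mem_roots w hr) (le_antisymm hv.2.2 h1)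
  constructor
  · ext v
    constructor
    · intro hv
      by_cases hv' : v ∈ G.N (G.cs.simple i)
      · exact .inl hv'
      · refine .inr ⟨G.rep (G.cs.simple i) v, ⟨⟨rep_mem_roots _ hv.1.1,
          refl_nonneg_of_not_mem i hv.1 hv'⟩, ?_⟩, rep_simple_rep_simple i v⟩
        rw [← rep_mul_apply]
        exact hv.2
    · rintro (hv | ⟨v, hv, rfl⟩)
      · refine ⟨hv.1, rep_mem_roots _ hv.1.1, ?_⟩
        rw [N_simple] at hv
        obtain ⟨hr, c, hc, rfl⟩ := hv
        rw [rep_mul_apply, map_smul, map_smul, rep_simple, refl_simpleRoot_self, map_neg, smul_neg]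
        exact neg_nonpos.2 (smul_nonneg hc.le hw)
      · refine ⟨⟨rep_mem_roots _ hv.1.1, refl_nonneg_of_not_mem i hv.1 (hnot v hv)⟩, ?_⟩
        rw [rep_mul_apply, rep_simple_rep_simple]
        exact hv.2
  · rw [Set.disjoint_left]
    rintro _ hv' ⟨v, hv, rfl⟩
    have := hv'.2.2
    rw [rep_simple_rep_simple] at this
    exact ne_zero_of_mem_roots hv.1.1 (le_antisymm this hv.1.2)

theorem encard_N_mul_simple {w : G.W} {i : ι} (h : ¬ G.cs.IsRightDescent w i) :
    (G.N (w * G.cs.simple i)).encard = (G.N w).encard + (G.N (G.cs.simple i)).encard := by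
  obtain ⟨h1, h2⟩ := N_mul_simple h
  rw [h1, Set.encard_union_eq h2, (G.rep (G.cs.simple i)).injective.encard_image, add_comm]

theorem N_one : G.N 1 = ∅ := by
  ext v
  simp only [Set.mem_empty_iff_false, iff_false]
  rintro ⟨⟨hv, h0⟩, -, h1⟩
  exact ne_zero_of_mem_roots hv (le_antisymm (by rwa [map_one] at h1) h0)

theorem finite_N_iff :
    (∀ w : G.W, (G.N w).Finite) ↔ ∀ i : ι, (G.N (G.cs.simple i)).Finite := by
  refine ⟨fun h i => h _, fun h w => ?_⟩
  refine induction_on_length (p := fun w => (G.N w).Finite) (by simp [N_one]) ?_ _ w rfl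
  intro w i hd hw
  rw [(N_mul_simple hd).1]
  exact (h i).union (hw.image _)

theorem encard_N_iff :
    (∀ w : G.W, (G.N w).encard = (G.length w : ℕ∞)) ↔
      ∀ i : ι, (G.N (G.cs.simple i)).encard = 1 := by
  constructor
  · intro h i
    rw [h, length, CoxeterSystem.length_simple, Nat.cast_one]
  · intro h w
    refine induction_on_length (p := fun w => (G.N w).encard = (G.length w : ℕ∞))
      (by simp [N_one, length]) ?_ _ w rfl
    intro w i hd hw
    rw [encard_N_mul_simple hd, hw, h, length, length, G.cs.not_isRightDescent_iff.1 hd]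
    push_cast
    rfl

theorem rep_pow_simpleRoot {w : G.W} {i : ι} {c : ℝ}
    (h : G.rep w (simpleRoot i) = c • simpleRoot i) (n : ℕ) :
    G.rep (w ^ n) (simpleRoot i) = c ^ n • simpleRoot i := by
  induction n with
  | zero => simp
  | succ n ih => rw [pow_succ', rep_mul_apply, ih, map_smul, h, smul_smul, pow_succ]

/-! ### The two criteria -/

theorem unitalONCyclic_of_finite (h : ∀ i : ι, (G.N (G.cs.simple i)).Finite) :
    G.UnitalONCyclic := by
  intro P hP
  obtain ⟨hc, w, hw⟩ := exists_rep_eq_scalar_smul _ P rfl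
  rw [hP] at hw
  by_contra hne
  -- The powers of a positive scalar other than 1 are distinct, and powers of w realize them all as
  -- roots.
  refine Set.infinite_of_injective_forall_mem (s := G.N (G.cs.simple (P.node 0)))
    (f := fun n : ℕ => P.scalar ^ n • (simpleRoot (P.node 0) : ι → ℝ)) ?_ ?_ (h _)
  · exact (smul_simpleRoot_injective _).comp (pow_right_injective₀ hc hne)
  · intro n
    rw [N_simple]
    exact ⟨⟨w ^ n, P.node 0, (rep_pow_simpleRoot hw n).symm⟩, _, pow_pos hc n, rfl⟩

/-- Each starting node j contributes at most one multiple of α_i: two scalars c, c' would make c /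
c' the scalar of a cycle at i. There are finitely many j. -/
theorem finite_of_unitalONCyclic (h : G.UnitalONCyclic) (i : ι) :
    (G.N (G.cs.simple i)).Finite := by
  have key : ∀ (j : ι) (w w' : G.W) (c c' : ℝ), 0 < c → 0 < c' →
      G.rep w (simpleRoot j) = c • simpleRoot i → G.rep w' (simpleRoot j) = c' • simpleRoot i →
      c = c' := by
    intro j w w' c c' hc hc' hw hw'
    have h1 : G.rep w'⁻¹ (simpleRoot i) = c'⁻¹ • simpleRoot j := by
      rw [← rep_inv_apply_rep_apply w' (simpleRoot j), hw', map_smul, smul_smul,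
        inv_mul_cancel₀ hc'.ne', one_smul]
    have h2 : G.rep (w * w'⁻¹) (simpleRoot i) = (c / c') • simpleRoot i := by
      rw [rep_mul_apply, h1, map_smul, hw, smul_smul, mul_comm, div_eq_mul_inv]
    obtain ⟨P, hs, he, hP⟩ := linked_of_rep_eq _ _ i i _ rfl (div_pos hc hc') h2
    have h3 := h P (he.trans hs.symm)
    rw [hP, div_eq_one_iff_eq hc'.ne'] at h3
    exact h3
  have hsub : G.N (G.cs.simple i) ⊆
      ⋃ j : ι, {v | ∃ (w : G.W) (c : ℝ), 0 < c ∧ v = c • simpleRoot i ∧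
        v = G.rep w (simpleRoot j)} := by
    intro v hv
    rw [N_simple] at hv
    obtain ⟨⟨w, j, hw⟩, c, hc, hv⟩ := hv
    exact Set.mem_iUnion.2 ⟨j, w, c, hc, hv, hw⟩
  refine (Set.finite_iUnion fun j => Set.Subsingleton.finite ?_).subset hsub
  rintro _ ⟨w, c, hc, rfl, hw⟩ _ ⟨w', c', hc', rfl, hw'⟩
  rw [key j w w' c c' hc hc' hw.symm hw'.symm]

/-- An odd asymmetry puts K_kj α_k ≠ α_k into N(s_k); without one, every factor of every path scalar
is 1. -/
theorem encard_N_simple_iff :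
    (∀ i : ι, (G.N (G.cs.simple i)).encard = 1) ↔ ∀ i j : ι, ¬ G.OddAsymmetry i j := by
  have hmem : ∀ i, simpleRoot i ∈ G.N (G.cs.simple i) := fun i => by
    rw [N_simple]
    exact ⟨simpleRoot_mem_roots i, 1, one_pos, by simp⟩
  constructor
  · rintro h j k ⟨ho, hne⟩
    obtain ⟨hK, w, hw⟩ := exists_rep_eq_K_smul ho
    have hm : G.K k j • simpleRoot k ∈ G.N (G.cs.simple k) := by
      rw [N_simple]
      exact ⟨⟨w, j, hw.symm⟩, _, hK, rfl⟩
    have he := Set.encard_le_one_iff.1 (h k).le _ _ hm (hmem k)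
    rw [← one_smul ℝ (simpleRoot k), smul_smul, mul_one] at he
    exact hne ((K_eq_one_iff ho).1 (smul_simpleRoot_injective k he))
  · intro h i
    rw [Set.encard_eq_one]
    refine ⟨simpleRoot i, Set.eq_singleton_iff_unique_mem.2 ⟨hmem i, fun v hv => ?_⟩⟩
    rw [N_simple] at hv
    obtain ⟨⟨w, j, hw⟩, c, hc, rfl⟩ := hv
    obtain ⟨P, -, -, rfl⟩ := linked_of_rep_eq _ w j i c rfl hc hw.symm
    have hP : P.scalar = 1 := Finset.prod_eq_one fun r _ =>
      (K_eq_one_iff (P.step r)).2 (by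
        by_contra hne
        exact h _ _ ⟨P.step r, hne⟩)
    rw [hP, one_smul]

end Representation

end EGCM

theorem corollary3p10 {ι : Type*} [Fintype ι] [DecidableEq ι] (G : EGCM ι) :
    ((∀ w : G.W, (G.N w).Finite) ↔ G.UnitalONCyclic) ∧
    ((∀ w : G.W, (G.N w).encard = (G.length w : ℕ∞)) ↔ ∀ i j : ι, ¬ G.OddAsymmetry i j) := by
  rw [EGCM.finite_N_iff, EGCM.encard_N_iff]
  exact ⟨⟨EGCM.unitalONCyclic_of_finite, EGCM.finite_of_unitalONCyclic⟩,
    EGCM.encard_N_simple_iff⟩
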